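/- Let $(M,\omega)$ be a closed (compact, without boundary) connected symplectic manifold of dimension $2n$ with $n\ge 3$, i.e. $\omega$ is a smooth, closed, non-degenerate differential $2$-form on the smooth manifold $M$. For $1\le k\le n$ let $\omega^k=\omega\wedge\dots\wedge\omega$ ($k$ factors), let $\mathrm{Diff}(M,\omega^k)$ be the group of all smooth diffeomorphisms $f:M\to M$ with $f^*\omega^k=\omega^k$, and let $\mathrm{Diff}_0(M,\omega^k)$ be its identity component, that is, the subgroup of all $f$ for which there is a family $(f_t)_{0\le t\le 1}$ in $\mathrm{Diff}(M,\omega^k)$ with $f_0=\mathrm{id}$, $f_1=f$ and $(t,x)\mapsto f_t(x)$ smooth on $[0,1]\times M$. Let $\mathrm{Symp}(M,\omega)$ be the group of all smooth diffeomorphisms $f$ of $M$ with $f^*\omega=\omega$, and $\mathrm{Symp}_0(M,\omega)$ its identity component in the same sense. Then $$\mathrm{Diff}_0(M,\omega^k)=\mathrm{Symp}_0(M,\omega)\qquad\text{for all } 0<k<n.$$ -/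

import Mathlib

open Set
open scoped Manifold ContDiff

noncomputable section

namespace SymplecticPower

section Linear

variable {V : Type*} [AddCommGroup V] [Module ℝ V]

/-- The wedge product of real-valued alternating forms, as a sum over shuffles
(so that `(dx ∧ dy) (∂x, ∂y) = 1`). -/
def wedge {p q : ℕ} (α : V [⋀^Fin p]→ₗ[ℝ] ℝ) (β : V [⋀^Fin q]→ₗ[ℝ] ℝ) :
    V [⋀^Fin (p + q)]→ₗ[ℝ] ℝ :=
  ((LinearMap.mul' ℝ ℝ).compAlternatingMap (α.domCoprod β)).domDomCongr finSumFinEquiv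

/-- The `k`-th exterior power `α ∧ ⋯ ∧ α` of an alternating `p`-form; the type is right because
`p * (k + 1)` unfolds to `p * k + p`. -/
def wedgePow {p : ℕ} (α : V [⋀^Fin p]→ₗ[ℝ] ℝ) : (k : ℕ) → V [⋀^Fin (p * k)]→ₗ[ℝ] ℝ
  | 0 => AlternatingMap.constOfIsEmpty ℝ V (Fin 0) (1 : ℝ)
  | k + 1 => wedge (wedgePow α k) α

end Linear

section Manifold

variable {d : ℕ} {M : Type*} [TopologicalSpace M] [ChartedSpace (EuclideanSpace ℝ (Fin d)) M]

/-- The coordinate expression of a field `α` of alternating `p`-forms in the preferred chart at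
`x₀`: its pullback under the inverse of the chart. -/
def inChart {p : ℕ} (α : ∀ x : M, TangentSpace (𝓡 d) x [⋀^Fin p]→L[ℝ] ℝ) (x₀ : M)
    (y : EuclideanSpace ℝ (Fin d)) : EuclideanSpace ℝ (Fin d) [⋀^Fin p]→L[ℝ] ℝ :=
  (α ((extChartAt (𝓡 d) x₀).symm y)).compContinuousLinearMap
    (mfderiv 𝓘(ℝ, EuclideanSpace ℝ (Fin d)) (𝓡 d) (extChartAt (𝓡 d) x₀).symm y)

variable (d M) in
/-- A symplectic form on `M`: a smooth, closed, non-degenerate differential `2`-form. -/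
structure SymplecticForm where
  /-- the value of the form at each point -/
  form : ∀ x : M, TangentSpace (𝓡 d) x [⋀^Fin 2]→L[ℝ] ℝ
  smooth : ∀ x₀ : M, ContDiffOn ℝ ∞ (inChart form x₀) (extChartAt (𝓡 d) x₀).target
  closed : ∀ x₀ : M, ∀ y ∈ (extChartAt (𝓡 d) x₀).target, extDeriv (inChart form x₀) y = 0
  nondegenerate : ∀ (x : M) (v : TangentSpace (𝓡 d) x), (∀ w, form x ![v, w] = 0) → v = 0

/-- The field of alternating `2k`-forms `Ω ^ k = Ω ∧ ⋯ ∧ Ω`. -/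
def SymplecticForm.pow (Ω : SymplecticForm d M) (k : ℕ) (x : M) :
    TangentSpace (𝓡 d) x [⋀^Fin (2 * k)]→ₗ[ℝ] ℝ :=
  wedgePow (Ω.form x).toAlternatingMap k

variable (d M) in
/-- Smooth diffeomorphisms of `M`. -/
abbrev Diffeo := M ≃ₘ⟮𝓡 d, 𝓡 d⟯ M

/-- Diffeomorphisms form a group, with `f * g = f ∘ g`. -/
instance : Group (Diffeo d M) where
  one := Diffeomorph.refl (𝓡 d) M ∞
  mul f g := g.trans f
  inv f := f.symm
  mul_assoc _ _ _ := rfl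
  one_mul _ := Diffeomorph.ext fun _ => rfl
  mul_one _ := Diffeomorph.ext fun _ => rfl
  inv_mul_cancel f := Diffeomorph.ext fun x => f.symm_apply_apply x

theorem mul_apply (f g : Diffeo d M) (x : M) : (f * g) x = f (g x) := rfl

theorem one_apply (x : M) : (1 : Diffeo d M) x = x := rfl

theorem mfderiv_mul (f g : Diffeo d M) (x : M) :
    mfderiv (𝓡 d) (𝓡 d) (f * g) x =
      (mfderiv (𝓡 d) (𝓡 d) f (g x)).comp (mfderiv (𝓡 d) (𝓡 d) g x) :=
  mfderiv_comp x ((f.contMDiff.mdifferentiable (by simp)) _)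
    ((g.contMDiff.mdifferentiable (by simp)) _)

theorem mfderiv_one (x : M) :
    mfderiv (𝓡 d) (𝓡 d) (1 : Diffeo d M) x = ContinuousLinearMap.id ℝ _ :=
  mfderiv_id

/-- The pullback at `x` of a field of alternating forms under a diffeomorphism. -/
def pullback {p : ℕ} (f : Diffeo d M) (α : ∀ x : M, TangentSpace (𝓡 d) x [⋀^Fin p]→ₗ[ℝ] ℝ)
    (x : M) : TangentSpace (𝓡 d) x [⋀^Fin p]→ₗ[ℝ] ℝ :=
  (α (f x)).compLinearMap (mfderiv (𝓡 d) (𝓡 d) f x).toLinearMap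

theorem pullback_one {p : ℕ} (α : ∀ x : M, TangentSpace (𝓡 d) x [⋀^Fin p]→ₗ[ℝ] ℝ) :
    pullback 1 α = α := by
  funext x
  ext v
  simp only [pullback, mfderiv_one]
  rfl

theorem pullback_mul {p : ℕ} (f g : Diffeo d M)
    (α : ∀ x : M, TangentSpace (𝓡 d) x [⋀^Fin p]→ₗ[ℝ] ℝ) :
    pullback (f * g) α = pullback g (pullback f α) := by
  funext x
  ext v
  simp only [pullback, mfderiv_mul]
  rfl

/-- `Diff(M, α)`: the group of diffeomorphisms `f` with `f^* α = α`. -/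
def diffPreserving {p : ℕ} (α : ∀ x : M, TangentSpace (𝓡 d) x [⋀^Fin p]→ₗ[ℝ] ℝ) :
    Subgroup (Diffeo d M) where
  carrier := {f | pullback f α = α}
  one_mem' := pullback_one α
  mul_mem' {f g} hf hg := by
    simp only [mem_ofPred_eq] at hf hg ⊢
    rw [pullback_mul, hf, hg]
  inv_mem' {f} hf := by
    simp only [mem_ofPred_eq] at hf ⊢
    calc pullback f⁻¹ α = pullback f⁻¹ (pullback f α) := by rw [hf]
      _ = α := by rw [← pullback_mul, mul_inv_cancel, pullback_one]

/-- `F` restricted to `[0, 1]` is a smooth family of diffeomorphisms: `(t, x) ↦ F t x` is smooth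
on `[0, 1] × M`. -/
def IsSmoothIsotopy (F : ℝ → Diffeo d M) : Prop :=
  ContMDiffOn (𝓘(ℝ, ℝ).prod (𝓡 d)) (𝓡 d) ∞ (fun q : ℝ × M => F q.1 q.2) (Icc 0 1 ×ˢ univ)

/-- The identity component of a group `H` of diffeomorphisms: the elements that are joined to the
identity by a smooth isotopy that stays in `H`. -/
def identityComponent (H : Subgroup (Diffeo d M)) : Subgroup (Diffeo d M) where
  carrier := {f | ∃ F : ℝ → Diffeo d M,
    IsSmoothIsotopy F ∧ (∀ t ∈ Icc (0 : ℝ) 1, F t ∈ H) ∧ F 0 = 1 ∧ F 1 = f}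
  one_mem' := ⟨fun _ => 1, contMDiff_snd.contMDiffOn, fun _ _ => H.one_mem, rfl, rfl⟩
  mul_mem' := by
    rintro f g ⟨F, hF, hFH, hF0, hF1⟩ ⟨G, hG, hGH, hG0, hG1⟩
    refine ⟨fun t => F t * G t, ?_, fun t ht => H.mul_mem (hFH t ht) (hGH t ht), ?_, ?_⟩
    · exact hF.comp (contMDiff_fst.contMDiffOn.prodMk hG) fun q hq => ⟨hq.1, mem_univ _⟩
    · simp only [hF0, hG0, mul_one]
    · simp only [hF1, hG1]
  inv_mem' := by
    rintro f ⟨F, hF, hFH, hF0, hF1⟩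
    have hmem : ∀ t ∈ Icc (0 : ℝ) 1, 1 - t ∈ Icc (0 : ℝ) 1 := fun t ht =>
      ⟨by linarith [ht.2], by linarith [ht.1]⟩
    refine ⟨fun t => F (1 - t) * f⁻¹, ?_, fun t ht => H.mul_mem (hFH _ (hmem t ht))
      (H.inv_mem (hF1 ▸ hFH 1 ⟨zero_le_one, le_rfl⟩)), ?_, ?_⟩
    · have h1 : ContMDiff (𝓘(ℝ, ℝ).prod (𝓡 d)) 𝓘(ℝ, ℝ) ∞ (fun q : ℝ × M => 1 - q.1) :=
        (contDiff_const.sub contDiff_id).contMDiff.comp contMDiff_fst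
      have h2 : ContMDiff (𝓘(ℝ, ℝ).prod (𝓡 d)) (𝓡 d) ∞ (fun q : ℝ × M => f⁻¹ q.2) :=
        (f⁻¹ : Diffeo d M).contMDiff.comp contMDiff_snd
      exact hF.comp (h1.prodMk h2).contMDiffOn fun q hq => ⟨hmem _ hq.1, mem_univ _⟩
    · simp only [sub_zero, hF1, mul_inv_cancel]
    · simp only [sub_self, hF0, one_mul]

/-- `Symp₀(M, Ω)`. -/
def symp₀ (Ω : SymplecticForm d M) : Subgroup (Diffeo d M) :=
  identityComponent (diffPreserving fun x => (Ω.form x).toAlternatingMap)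

/-- `G_k = Diff₀(M, Ω ^ k)`. -/
def diff₀ (Ω : SymplecticForm d M) (k : ℕ) : Subgroup (Diffeo d M) :=
  identityComponent (diffPreserving (Ω.pow k))

end Manifold

end SymplecticPower

end

/-!
Pointwise, a `2`-form `α` is determined up to sign by `α ^ k` as soon as `2k < rank α`. Indeed, let
`α ^ k = β ^ k` and `β (u, v) = 0`. The hyperplane `X = ker β (u, ·)` contains `u` and `v`, and
`β ^ k` vanishes on every family of vectors of `X` that contains `u`. The restriction of `α` to `X`
has rank at least `2k - 1`; if `α (u, v)` were nonzero, then `u` and a multiple of `v` could be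
completed to `k` orthogonal hyperbolic pairs of `α` in `X`, on which `α ^ k` is nonzero. So
`β (u, v) = 0` implies `α (u, v) = 0`, whence `α = c β`, with `c ^ k = 1` and therefore `c = ±1`.

If the isotopy `f_t` preserves `ω ^ k`, then `f_t^* ω = ±ω` at each point; the sign is constant
because `f_t^* ω` depends continuously on `t`, and it is `+` at `t = 0`.
-/

namespace SymplecticPower

section BilinearForms

variable {K V : Type*} [Field K] [AddCommGroup V] [Module K V]

theorem exists_eq_smul_of_forall_eq_zero_imp {W : Type*} [AddCommGroup W] [Module K W]
    {B C : V →ₗ[K] W →ₗ[K] K} (h : ∀ u v, C u v = 0 → B u v = 0) : ∃ c : K, B = c • C := by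
  by_cases hC : C = 0
  · exact ⟨0, by ext u v; simp [h u v (by simp [hC])]⟩
  obtain ⟨u₀, v₀, h₀⟩ : ∃ u₀ v₀, C u₀ v₀ ≠ 0 := by
    by_contra! h₀
    exact hC (LinearMap.ext₂ h₀)
  refine ⟨B u₀ v₀ / C u₀ v₀, ?_⟩
  set D := B - (B u₀ v₀ / C u₀ v₀) • C with hD
  have hD_zero {u v} (huv : C u v = 0) : D u v = 0 := by simp [hD, h u v huv, huv]
  have hD₀ : D u₀ v₀ = 0 := by simp [hD, h₀]
  have hD_left (v) : D u₀ v = 0 := by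
    simpa [hD₀] using hD_zero (u := u₀) (v := v - (C u₀ v / C u₀ v₀) • v₀) (by simp [h₀])
  have hD_right (u) : D u v₀ = 0 := by
    simpa [hD₀] using hD_zero (u := u - (C u v₀ / C u₀ v₀) • u₀) (v := v₀) (by simp [h₀])
  refine sub_eq_zero.mp (LinearMap.ext₂ fun u v => ?_)
  -- `(u', v')` differs from `(u, v)` by multiples of `u₀, v₀`, and `C u' v₀ = 1`.
  set u' := u + ((1 - C u v₀) / C u₀ v₀) • u₀ with hu'
  have hCu' : C u' v₀ = 1 := by simp [hu', h₀]
  have := hD_zero (u := u') (v := v - C u' v • v₀) (by simp [hCu'])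
  rwa [map_sub, map_smul, hD_right, smul_zero, sub_zero, hu', map_add, map_smul,
    LinearMap.add_apply, LinearMap.smul_apply, hD_left, smul_zero, add_zero] at this

theorem finrank_le_finrank_map_add_finrank_ker [FiniteDimensional K V] {W : Type*}
    [AddCommGroup W] [Module K W] (f : V →ₗ[K] W) (X : Submodule K V) :
    Module.finrank K X ≤ Module.finrank K (X.map f) + Module.finrank K (LinearMap.ker f) := by
  have hker : (LinearMap.ker (f.domRestrict X)).map X.subtype ≤ LinearMap.ker f := by
    rintro _ ⟨x, hx, rfl⟩
    exact hx
  rw [← (f.domRestrict X).finrank_range_add_finrank_ker, LinearMap.range_domRestrict,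
    ← Submodule.finrank_map_subtype_eq X (LinearMap.ker _)]
  exact Nat.add_le_add_left (Submodule.finrank_mono hker) _

variable {B : LinearMap.BilinForm K V}

variable (B) in
theorem finrank_range_add_two_mul_finrank_le_restrict [FiniteDimensional K V] (X : Submodule K V) :
    Module.finrank K (LinearMap.range B) + 2 * Module.finrank K X ≤
      Module.finrank K (LinearMap.range (B.restrict X)) + 2 * Module.finrank K V := by
  set N := (LinearMap.ker (B.restrict X)).map X.subtype
  have hmap : N.map B ≤ X.dualAnnihilator := by
    rintro _ ⟨_, ⟨x, hx, rfl⟩, rfl⟩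
    exact (Submodule.mem_dualAnnihilator _).mpr fun y hy => LinearMap.congr_fun hx ⟨y, hy⟩
  have hN_finrank : Module.finrank K N = Module.finrank K (LinearMap.ker (B.restrict X)) :=
    Submodule.finrank_map_subtype_eq X _
  have h₁ := finrank_le_finrank_map_add_finrank_ker B N
  have h₂ : Module.finrank K (N.map B) ≤ Module.finrank K X.dualAnnihilator :=
    Submodule.finrank_mono hmap
  have h₃ : Module.finrank K X + Module.finrank K X.dualAnnihilator = Module.finrank K V :=
    Subspace.finrank_add_finrank_dualAnnihilator_eq X
  have h₄ := B.finrank_range_add_finrank_ker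
  have h₅ := (B.restrict X).finrank_range_add_finrank_ker
  omega

theorem finrank_le_finrank_ker_add_one [FiniteDimensional K V] (l : V →ₗ[K] K) :
    Module.finrank K V ≤ Module.finrank K (LinearMap.ker l) + 1 := by
  rw [← l.finrank_range_add_finrank_ker, add_comm]
  exact Nat.add_le_add_left ((Submodule.finrank_le _).trans_eq (Module.finrank_self K)) _

theorem exists_apply_eq_one (hB : B ≠ 0) : ∃ e f, B e f = 1 := by
  obtain ⟨e, f, hef⟩ : ∃ e f, B e f ≠ 0 := by
    by_contra! h
    exact hB (LinearMap.ext₂ h)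
  exact ⟨e, (B e f)⁻¹ • f, by simp [hef]⟩

variable (B) in
/-- The orthogonal complement of the pair `(e, f)` with respect to `B`, as a kernel. -/
def orthogonalPair (e f : V) : Submodule K V :=
  LinearMap.ker ((B e).prod (B f))

theorem mem_orthogonalPair {e f x : V} : x ∈ orthogonalPair B e f ↔ B e x = 0 ∧ B f x = 0 := by
  simp [orthogonalPair]

theorem ker_restrict_orthogonalPair_le (hB : B.IsAlt) {e f : V} (hef : B e f = 1) :
    (LinearMap.ker (B.restrict (orthogonalPair B e f))).map (orthogonalPair B e f).subtype ≤
      LinearMap.ker B := by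
  rintro _ ⟨⟨x, hx⟩, hxW, rfl⟩
  obtain ⟨hex, hfx⟩ := mem_orthogonalPair.mp hx
  have hxe : B x e = 0 := by rw [← hB.neg_eq, hex, neg_zero]
  have hxf : B x f = 0 := by rw [← hB.neg_eq, hfx, neg_zero]
  have hfe : B f e = -1 := by rw [← hB.neg_eq, hef]
  ext y
  have hy : y - B e y • f + B f y • e ∈ orthogonalPair B e f :=
    mem_orthogonalPair.mpr ⟨by simp [hB.self_eq_zero, hef], by simp [hB.self_eq_zero, hfe]⟩
  have : B x (y - B e y • f + B f y • e) = 0 := LinearMap.congr_fun hxW ⟨_, hy⟩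
  simpa [hxe, hxf] using this

theorem finrank_range_le_restrict_orthogonalPair_add_two [FiniteDimensional K V] (hB : B.IsAlt)
    {e f : V} (hef : B e f = 1) :
    Module.finrank K (LinearMap.range B) ≤
      Module.finrank K (LinearMap.range (B.restrict (orthogonalPair B e f))) + 2 := by
  have hker := Submodule.finrank_mono (ker_restrict_orthogonalPair_le hB hef)
  rw [Submodule.finrank_map_subtype_eq] at hker
  have hcodim : Module.finrank K (LinearMap.range ((B e).prod (B f))) ≤ 2 :=
    (Submodule.finrank_le _).trans_eq (by simp)
  have h₁ : _ + Module.finrank K (orthogonalPair B e f) = _ :=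
    ((B e).prod (B f)).finrank_range_add_finrank_ker
  have h₂ := B.finrank_range_add_finrank_ker
  have h₃ := (B.restrict (orthogonalPair B e f)).finrank_range_add_finrank_ker
  omega

variable (B) in
/-- A family of pairwise `B`-orthogonal hyperbolic pairs, that is, the first vectors of a
symplectic basis: `w i 0` and `w i 1` are the two vectors of the `i`-th pair. -/
structure IsHyperbolic {ι : Type*} (w : ι → Fin 2 → V) : Prop where
  pair : ∀ i, B (w i 0) (w i 1) = 1
  orthogonal : ∀ i j a b, i ≠ j → B (w i a) (w j b) = 0

theorem IsHyperbolic.of_restrict {X : Submodule K V} {ι : Type*} {w : ι → Fin 2 → X}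
    (hw : IsHyperbolic (B.restrict X) w) : IsHyperbolic B fun i a => (w i a : V) :=
  ⟨hw.pair, hw.orthogonal⟩

theorem IsHyperbolic.cons (hB : B.IsAlt) {e f : V} (hef : B e f = 1) {k : ℕ}
    {w : Fin k → Fin 2 → V} (hw : IsHyperbolic B w) (hwo : ∀ i a, w i a ∈ orthogonalPair B e f) :
    IsHyperbolic B (Fin.cons ![e, f] w : Fin (k + 1) → Fin 2 → V) := by
  have h₀ (a j b) : B (![e, f] a) (w j b) = 0 := by
    fin_cases a
    exacts [(mem_orthogonalPair.mp (hwo j b)).1, (mem_orthogonalPair.mp (hwo j b)).2]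
  refine ⟨Fin.cases hef hw.pair, fun i j a b hij => ?_⟩
  cases i using Fin.cases with
  | zero =>
    cases j using Fin.cases with
    | zero => exact absurd rfl hij
    | succ j => exact h₀ a j b
  | succ i =>
    cases j using Fin.cases with
    | zero => exact hB.isRefl _ _ (h₀ b i a)
    | succ j => exact hw.orthogonal i j a b fun h => hij (congrArg Fin.succ h)

variable [FiniteDimensional K V]

-- Since the rank of an alternating form is even, `2 * k - 1 ≤ rank B` already yields `k` pairs.
theorem exists_isHyperbolic (hB : B.IsAlt) {k : ℕ}
    (hk : 2 * k ≤ Module.finrank K (LinearMap.range B) + 1) :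
    ∃ w : Fin k → Fin 2 → V, IsHyperbolic B w := by
  induction k generalizing V with
  | zero => exact ⟨Fin.elim0, ⟨fun i => i.elim0, fun i => i.elim0⟩⟩
  | succ k ih =>
    have hB₀ : B ≠ 0 := by
      rintro rfl
      rw [LinearMap.range_zero, finrank_bot] at hk
      omega
    obtain ⟨e, f, hef⟩ := exists_apply_eq_one hB₀
    have hrank := finrank_range_le_restrict_orthogonalPair_add_two hB hef
    obtain ⟨w, hw⟩ := ih (B := B.restrict (orthogonalPair B e f)) (fun x => hB x) (by omega)
    exact ⟨_, hw.of_restrict.cons hB hef fun i a => (w i a).2⟩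

theorem exists_isHyperbolic_of_pair (hB : B.IsAlt) {e f : V} (hef : B e f = 1) {k : ℕ}
    (hk : 2 * (k + 1) ≤ Module.finrank K (LinearMap.range B) + 1) :
    ∃ w : Fin (k + 1) → Fin 2 → V, IsHyperbolic B w ∧ w 0 = ![e, f] := by
  have hrank := finrank_range_le_restrict_orthogonalPair_add_two hB hef
  obtain ⟨w, hw⟩ := exists_isHyperbolic (B := B.restrict (orthogonalPair B e f)) (fun x => hB x)
    (show 2 * k ≤ _ by omega)
  exact ⟨_, hw.of_restrict.cons hB hef fun i a => (w i a).2, rfl⟩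

end BilinearForms


section ExteriorPowers

variable {V : Type*} [AddCommGroup V] [Module ℝ V] {p q : ℕ}

theorem wedge_smul_smul (a b : ℝ) (α : V [⋀^Fin p]→ₗ[ℝ] ℝ) (β : V [⋀^Fin q]→ₗ[ℝ] ℝ) :
    wedge (a • α) (b • β) = (a * b) • wedge α β := by
  have h : (a • α).domCoprod (b • β) = (a * b) • α.domCoprod β := by
    rw [← AlternatingMap.domCoprod'_apply, ← TensorProduct.smul_tmul', TensorProduct.tmul_smul,
      map_smul, map_smul, AlternatingMap.domCoprod'_apply, smul_smul]
  ext v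
  simp [wedge, h]

theorem wedgePow_smul (c : ℝ) (α : V [⋀^Fin p]→ₗ[ℝ] ℝ) (k : ℕ) :
    wedgePow (c • α) k = c ^ k • wedgePow α k := by
  induction k with
  | zero => simp [wedgePow]
  | succ k ih => rw [wedgePow, ih, wedge_smul_smul, ← pow_succ, wedgePow]

theorem alternatization_domDomCongr {ι κ : Type*} [Fintype ι] [DecidableEq ι] [Fintype κ]
    [DecidableEq κ] (e : ι ≃ κ) (m : MultilinearMap ℝ (fun _ : ι => V) ℝ) :
    MultilinearMap.alternatization (m.domDomCongr e) =
      (MultilinearMap.alternatization m).domDomCongr e := by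
  ext v
  simp only [AlternatingMap.domDomCongr_apply, MultilinearMap.alternatization_apply]
  refine (Fintype.sum_equiv e.permCongr _ _ fun σ => ?_).symm
  simp [Equiv.Perm.sign_permCongr, Function.comp_def]

/-- The tensor product of two forms: the multilinear analogue of `wedge`, without the sum over
shuffles. -/
def tensor (a : MultilinearMap ℝ (fun _ : Fin p => V) ℝ)
    (b : MultilinearMap ℝ (fun _ : Fin q => V) ℝ) :
    MultilinearMap ℝ (fun _ : Fin (p + q) => V) ℝ :=
  ((LinearMap.mul' ℝ ℝ).compMultilinearMap (a.domCoprod b)).domDomCongr finSumFinEquiv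

theorem alternatization_tensor (a : MultilinearMap ℝ (fun _ : Fin p => V) ℝ)
    (b : MultilinearMap ℝ (fun _ : Fin q => V) ℝ) :
    MultilinearMap.alternatization (tensor a b) =
      wedge (MultilinearMap.alternatization a) (MultilinearMap.alternatization b) := by
  rw [tensor, alternatization_domDomCongr, LinearMap.compMultilinearMap_alternatization,
    MultilinearMap.domCoprod_alternization, wedge]

/-- The (non-alternating) `k`-th tensor power `α ⊗ ⋯ ⊗ α` of an alternating `p`-form. -/
def tensorPow (α : V [⋀^Fin p]→ₗ[ℝ] ℝ) :
    (k : ℕ) → MultilinearMap ℝ (fun _ : Fin (p * k) => V) ℝ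
  | 0 => MultilinearMap.constOfIsEmpty ℝ (fun _ : Fin 0 => V) 1
  | k + 1 => tensor (tensorPow α k) α.toMultilinearMap

theorem factorial_pow_smul_wedgePow (α : V [⋀^Fin p]→ₗ[ℝ] ℝ) (k : ℕ) :
    (p.factorial ^ k : ℝ) • wedgePow α k = MultilinearMap.alternatization (tensorPow α k) := by
  induction k with
  | zero =>
    ext v
    simp [wedgePow, tensorPow, MultilinearMap.alternatization_apply]
  | succ k ih =>
    have hα : MultilinearMap.alternatization α.toMultilinearMap = (p.factorial : ℝ) • α := by
      rw [AlternatingMap.coe_alternatization, Fintype.card_fin, Nat.cast_smul_eq_nsmul]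
    rw [tensorPow, alternatization_tensor, ← ih, hα, wedge_smul_smul, ← pow_succ, wedgePow]

variable (p) in
/-- The division of `Fin (p * k)` into `k` consecutive blocks of length `p`. -/
def blockEquiv (k : ℕ) : Fin k × Fin p ≃ Fin (p * k) :=
  finProdFinEquiv.trans (finCongr (mul_comm k p))

theorem tensorPow_apply (α : V [⋀^Fin p]→ₗ[ℝ] ℝ) (k : ℕ) (v : Fin (p * k) → V) :
    tensorPow α k v = ∏ i, α fun j => v (blockEquiv p k (i, j)) := by
  induction k with
  | zero => simp [tensorPow]
  | succ k ih =>
    have hlast (j : Fin p) : finSumFinEquiv (Sum.inr j) = blockEquiv p (k + 1) (Fin.last k, j) :=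
      Fin.ext (by simp [blockEquiv, add_comm])
    rw [Fin.prod_univ_castSucc]
    change tensorPow α k (fun i => v (finSumFinEquiv (Sum.inl i))) *
      α (fun j => v (finSumFinEquiv (Sum.inr j))) = _
    simp only [ih, hlast]
    rfl

theorem factorial_pow_mul_wedgePow_apply (α : V [⋀^Fin p]→ₗ[ℝ] ℝ) (k : ℕ)
    (w : Fin k × Fin p → V) :
    p.factorial ^ k * wedgePow α k (w ∘ (blockEquiv p k).symm) =
      ∑ σ : Equiv.Perm (Fin k × Fin p), ((Equiv.Perm.sign σ : ℤ) : ℝ) *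
        ∏ i, α fun j => w (σ (i, j)) := by
  rw [← smul_eq_mul, ← AlternatingMap.smul_apply, factorial_pow_smul_wedgePow,
    MultilinearMap.alternatization_apply]
  refine (Fintype.sum_equiv (blockEquiv p k).permCongr _ _ fun σ => ?_).symm
  simp [tensorPow_apply, Equiv.Perm.sign_permCongr, Units.smul_def]

theorem wedgePow_compLinearMap {W : Type*} [AddCommGroup W] [Module ℝ W]
    (α : V [⋀^Fin p]→ₗ[ℝ] ℝ) (A : W →ₗ[ℝ] V) (k : ℕ) :
    wedgePow (α.compLinearMap A) k = (wedgePow α k).compLinearMap A := by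
  ext v
  have h₁ := factorial_pow_mul_wedgePow_apply (α.compLinearMap A) k (v ∘ blockEquiv p k)
  have h₂ := factorial_pow_mul_wedgePow_apply α k (A ∘ v ∘ blockEquiv p k)
  simp only [Function.comp_assoc, Equiv.self_comp_symm, Function.comp_id] at h₁ h₂
  exact mul_left_cancel₀ (pow_ne_zero k (Nat.cast_ne_zero.mpr p.factorial_ne_zero))
    (h₁.trans h₂.symm)

theorem wedgePow_apply_eq_zero (α : V [⋀^Fin p]→ₗ[ℝ] ℝ) {k : ℕ} {w : Fin k × Fin p → V}
    (x : Fin k × Fin p)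
    (h : ∀ s : Fin p → Fin k × Fin p, x ∈ range s → α (w ∘ s) = 0) :
    wedgePow α k (w ∘ (blockEquiv p k).symm) = 0 := by
  have hsum := factorial_pow_mul_wedgePow_apply α k w
  rw [Finset.sum_eq_zero fun σ _ => ?_] at hsum
  · exact (mul_eq_zero.mp hsum).resolve_left
      (pow_ne_zero k (Nat.cast_ne_zero.mpr p.factorial_ne_zero))
  · rw [Finset.prod_eq_zero (Finset.mem_univ (σ.symm x).1), mul_zero]
    exact h (fun j => σ ((σ.symm x).1, j)) ⟨(σ.symm x).2, σ.apply_symm_apply x⟩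

theorem exists_eq_prodCongrLeft_mul_prodCongrRight {ι κ : Type*} [Finite ι] [Finite κ] [Nonempty κ]
    {σ : Equiv.Perm (ι × κ)} (h : ∀ i a b, (σ (i, a)).1 = (σ (i, b)).1) :
    ∃ (τ : Equiv.Perm ι) (ε : ι → Equiv.Perm κ),
      σ = (Equiv.prodCongrLeft fun _ => τ) * Equiv.prodCongrRight ε := by
  obtain ⟨a₀⟩ := ‹Nonempty κ›
  have hτ : Function.Surjective fun i => (σ (i, a₀)).1 := fun j => by
    obtain ⟨⟨i, a⟩, hi⟩ := σ.surjective (j, a₀)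
    exact ⟨i, (h i a₀ a).trans (congrArg Prod.fst hi)⟩
  have hε (i : ι) : Function.Injective fun a => (σ (i, a)).2 := fun a b hab =>
    (Prod.ext_iff.mp (σ.injective (Prod.ext (h i a b) hab))).2
  refine ⟨Equiv.ofBijective _ (Finite.surjective_iff_bijective.mp hτ),
    fun i => Equiv.ofBijective _ (Finite.injective_iff_bijective.mp (hε i)), ?_⟩
  ext ⟨i, a⟩ : 1
  exact Prod.ext (h i a a₀) rfl

end ExteriorPowers

section TwoForms

theorem update_pair_one {V : Type*} (u w v : V) : Function.update ![u, w] 1 v = ![u, v] := by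
  ext i
  fin_cases i <;> rfl

variable {V : Type*} [AddCommGroup V] [Module ℝ V]

/-- An alternating `2`-form as a bilinear form, for which Mathlib has kernels, ranks and
restrictions. -/
def toBilin (α : V [⋀^Fin 2]→ₗ[ℝ] ℝ) : LinearMap.BilinForm ℝ V :=
  LinearMap.mk₂ ℝ (fun u v => α ![u, v])
    (fun u u' v => by simpa using α.map_vecCons_add ![v] u u')
    (fun c u v => by simpa using α.map_vecCons_smul ![v] c u)
    (fun u v v' => by simpa only [update_pair_one] using α.map_update_add ![u, 0] 1 v v')
    (fun c u v => by simpa only [update_pair_one] using α.map_update_smul ![u, 0] 1 c v)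

theorem apply_eq_toBilin (α : V [⋀^Fin 2]→ₗ[ℝ] ℝ) (v : Fin 2 → V) :
    α v = toBilin α (v 0) (v 1) :=
  congrArg α (List.ofFn_injective rfl)

theorem isAlt_toBilin (α : V [⋀^Fin 2]→ₗ[ℝ] ℝ) : (toBilin α).IsAlt := fun u =>
  α.map_eq_zero_of_eq ![u, u] (i := 0) (j := 1) rfl (by decide)

variable {α β : V [⋀^Fin 2]→ₗ[ℝ] ℝ} {k : ℕ} {w : Fin k → Fin 2 → V}

theorem wedgePow_apply_eq_zero_of_toBilin {v : Fin k × Fin 2 → V} (x : Fin k × Fin 2)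
    (h : ∀ y, toBilin α (v x) (v y) = 0) :
    wedgePow α k (v ∘ (blockEquiv 2 k).symm) = 0 := by
  refine wedgePow_apply_eq_zero α x ?_
  rintro s ⟨a, rfl⟩
  rw [apply_eq_toBilin]
  fin_cases a
  · exact h (s 1)
  · exact (isAlt_toBilin α).isRefl _ _ (h (s 0))

namespace IsHyperbolic

theorem apply_perm (hw : IsHyperbolic (toBilin α) w) (i : Fin k) (ε : Equiv.Perm (Fin 2)) :
    α (w i ∘ ε) = ((Equiv.Perm.sign ε : ℤ) : ℝ) := by
  rw [AlternatingMap.map_perm, apply_eq_toBilin, hw.pair, Units.smul_def, zsmul_one]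

theorem sign_mul_prod_nonneg (hw : IsHyperbolic (toBilin α) w)
    (σ : Equiv.Perm (Fin k × Fin 2)) :
    0 ≤ ((Equiv.Perm.sign σ : ℤ) : ℝ) * ∏ i, α fun j => Function.uncurry w (σ (i, j)) := by
  by_cases hσ : ∀ i a b, (σ (i, a)).1 = (σ (i, b)).1
  · obtain ⟨τ, ε, rfl⟩ := exists_eq_prodCongrLeft_mul_prodCongrRight hσ
    have hsign : Equiv.Perm.sign ((Equiv.prodCongrLeft fun _ : Fin 2 => τ) *
        Equiv.prodCongrRight ε) = ∏ i, Equiv.Perm.sign (ε i) := by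
      simp [Equiv.Perm.sign_prodCongrRight, Equiv.Perm.sign_prodCongrLeft]
    have hprod : ∏ i, α (fun j => Function.uncurry w
        (((Equiv.prodCongrLeft fun _ => τ) * Equiv.prodCongrRight ε : Equiv.Perm _) (i, j))) =
        ((∏ i, Equiv.Perm.sign (ε i) : ℤˣ) : ℤ) := by
      push_cast
      exact Finset.prod_congr rfl fun i _ => hw.apply_perm (τ i) (ε i)
    rw [hsign, hprod]
    exact mul_self_nonneg _
  · push Not at hσ
    obtain ⟨i, a, b, hab⟩ := hσ
    have h01 : (σ (i, 0)).1 ≠ (σ (i, 1)).1 := fun h => by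
      fin_cases a <;> fin_cases b <;> simp_all
    rw [Finset.prod_eq_zero (Finset.mem_univ i), mul_zero]
    rw [apply_eq_toBilin]
    exact hw.orthogonal _ _ _ _ h01

theorem wedgePow_ne_zero (hw : IsHyperbolic (toBilin α) w) :
    wedgePow α k (Function.uncurry w ∘ (blockEquiv 2 k).symm) ≠ 0 := by
  intro h
  have hsum := factorial_pow_mul_wedgePow_apply α k (Function.uncurry w)
  rw [h, mul_zero] at hsum
  refine (Finset.sum_pos' (fun σ _ => hw.sign_mul_prod_nonneg σ) ⟨1, Finset.mem_univ _, ?_⟩).ne hsum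
  simp [apply_eq_toBilin, hw.pair]

end IsHyperbolic

section FiniteDimensional

variable [FiniteDimensional ℝ V]

theorem toBilin_eq_zero_of_wedgePow_eq (hk : k ≠ 0)
    (hrank : 2 * k < Module.finrank ℝ (LinearMap.range (toBilin α)))
    (h : wedgePow α k = wedgePow β k) {u v : V} (huv : toBilin β u v = 0) :
    toBilin α u v = 0 := by
  by_contra hne
  obtain ⟨k, rfl⟩ := Nat.exists_eq_succ_of_ne_zero hk
  let X := LinearMap.ker (toBilin β u)
  let e : X := ⟨u, isAlt_toBilin β u⟩
  let f : X := (toBilin α u v)⁻¹ • ⟨v, huv⟩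
  have hef : (toBilin α).restrict X e f = 1 := by
    simp [e, f, LinearMap.BilinForm.restrict_apply, hne]
  have hX : Module.finrank ℝ V ≤ Module.finrank ℝ X + 1 := finrank_le_finrank_ker_add_one _
  have hαX := finrank_range_add_two_mul_finrank_le_restrict (toBilin α) X
  obtain ⟨w, hw, hw₀⟩ := exists_isHyperbolic_of_pair (B := (toBilin α).restrict X) (k := k)
    (fun x => isAlt_toBilin α x) hef (by omega)
  refine hw.of_restrict.wedgePow_ne_zero ?_
  rw [h]
  refine wedgePow_apply_eq_zero_of_toBilin (0, 0) fun y => ?_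
  have hw₀₀ : (w 0 0 : V) = u := by rw [hw₀]; rfl
  have hwX : toBilin β u (w y.1 y.2) = 0 := (w y.1 y.2).2
  rwa [← hw₀₀] at hwX

theorem eq_or_eq_neg_of_wedgePow_eq (hk : k ≠ 0)
    (hrank : 2 * k < Module.finrank ℝ (LinearMap.range (toBilin α)))
    (h : wedgePow α k = wedgePow β k) : β = α ∨ β = -α := by
  obtain ⟨c, hc⟩ := exists_eq_smul_of_forall_eq_zero_imp
    fun u v => toBilin_eq_zero_of_wedgePow_eq hk hrank h
  have hcβ : α = c • β := AlternatingMap.ext fun v => by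
    rw [AlternatingMap.smul_apply, apply_eq_toBilin, apply_eq_toBilin, hc]
    rfl
  obtain ⟨w, hw⟩ := exists_isHyperbolic (isAlt_toBilin α) (k := k) (by omega)
  have hpow : c ^ k = 1 := by
    have hα : c ^ k • wedgePow α k = wedgePow α k := by
      rw [h, ← wedgePow_smul, ← hcβ, h]
    refine mul_right_cancel₀ hw.wedgePow_ne_zero ?_
    rw [one_mul, ← smul_eq_mul, ← AlternatingMap.smul_apply, hα]
  have habs : |c| = 1 :=
    (pow_eq_one_iff_of_nonneg (abs_nonneg c) hk).mp (by rw [← abs_pow, hpow, abs_one])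
  obtain rfl | rfl := eq_or_eq_neg_of_abs_eq habs
  · exact .inl (by rw [hcβ, one_smul])
  · exact .inr (by rw [hcβ]; module)

end FiniteDimensional

end TwoForms

section Manifold

variable {d p : ℕ} {M : Type*} [TopologicalSpace M] [ChartedSpace (EuclideanSpace ℝ (Fin d)) M]

section Continuity

variable [IsManifold (𝓡 d) 1 M]

theorem inChart_mfderiv (θ : ∀ x : M, TangentSpace (𝓡 d) x [⋀^Fin p]→L[ℝ] ℝ) {x₀ x : M}
    (hx : x ∈ (extChartAt (𝓡 d) x₀).source) (v : Fin p → TangentSpace (𝓡 d) x) :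
    inChart θ x₀ (extChartAt (𝓡 d) x₀ x)
      (fun i => mfderiv (𝓡 d) 𝓘(ℝ, EuclideanSpace ℝ (Fin d)) (extChartAt (𝓡 d) x₀) x (v i)) =
      θ x v := by
  have hinv := mfderivWithin_extChartAt_symm_comp_mfderiv_extChartAt' (I := 𝓡 d) hx
  rw [ModelWithCorners.range_eq_univ, mfderivWithin_univ] at hinv
  have hθ (y : M) (hy : y = x) (u : Fin p → EuclideanSpace ℝ (Fin d)) : θ y u = θ x u := by
    subst hy
    rfl
  exact (hθ _ ((extChartAt (𝓡 d) x₀).left_inv hx) _).trans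
    (congrArg (θ x) (funext fun i => DFunLike.congr_fun hinv (v i)))

variable {T : Type*} [TopologicalSpace T] {s : Set T} {t₀ : T} {b : T → M}

theorem continuousWithinAt_mfderiv_extChartAt {U : ∀ t, TangentSpace (𝓡 d) (b t)}
    (hU : ContinuousWithinAt (fun t => (⟨b t, U t⟩ : TangentBundle (𝓡 d) M)) s t₀) :
    ContinuousWithinAt (fun t => (mfderiv (𝓡 d) 𝓘(ℝ, EuclideanSpace ℝ (Fin d))
      (extChartAt (𝓡 d) (b t₀)) (b t) (U t) : EuclideanSpace ℝ (Fin d))) s t₀ := by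
  obtain ⟨hb, hfiber⟩ :=
    (FiberBundle.continuousWithinAt_totalSpace (EuclideanSpace ℝ (Fin d)) _).mp hU
  have htriv {t : T} (ht : b t ∈ (chartAt (EuclideanSpace ℝ (Fin d)) (b t₀)).source) :
      (mfderiv (𝓡 d) 𝓘(ℝ, EuclideanSpace ℝ (Fin d)) (extChartAt (𝓡 d) (b t₀)) (b t) (U t) :
        EuclideanSpace ℝ (Fin d)) =
      (trivializationAt (EuclideanSpace ℝ (Fin d)) (TangentSpace (𝓡 d)) (b t₀)
        (⟨b t, U t⟩ : TangentBundle (𝓡 d) M)).2 := by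
    rw [← TangentBundle.continuousLinearMapAt_trivializationAt ht]
    exact Bundle.Trivialization.continuousLinearMapAt_apply_of_mem ℝ
      (trivializationAt (EuclideanSpace ℝ (Fin d)) (TangentSpace (𝓡 d) (M := M)) (b t₀))
      (by simpa using ht) (U t)
  exact hfiber.congr_of_eventuallyEq
    ((hb.eventually ((chartAt _ (b t₀)).open_source.mem_nhds (mem_chart_source _ _))).mono
      fun _ => htriv) (htriv (mem_chart_source _ _))

theorem continuousWithinAt_form_apply {θ : ∀ x : M, TangentSpace (𝓡 d) x [⋀^Fin p]→L[ℝ] ℝ}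
    {V : ∀ t, Fin p → TangentSpace (𝓡 d) (b t)}
    (hθ : ContinuousOn (inChart θ (b t₀)) (extChartAt (𝓡 d) (b t₀)).target)
    (hb : ContinuousWithinAt b s t₀)
    (hV : ∀ i, ContinuousWithinAt (fun t => (⟨b t, V t i⟩ : TangentBundle (𝓡 d) M)) s t₀) :
    ContinuousWithinAt (fun t => θ (b t) (V t)) s t₀ := by
  have hform : ContinuousWithinAt (fun t => inChart θ (b t₀) (extChartAt (𝓡 d) (b t₀) (b t)))
      s t₀ :=
    (hθ.continuousAt (extChartAt_target_mem_nhds (b t₀))).tendsto.comp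
      ((continuousAt_extChartAt (I := 𝓡 d) (b t₀)).comp_continuousWithinAt hb)
  have hchart := hform.eval (continuousWithinAt_pi.mpr fun i =>
    continuousWithinAt_mfderiv_extChartAt (hV i))
  exact hchart.congr_of_eventuallyEq
    ((hb.eventually (extChartAt_source_mem_nhds (I := 𝓡 d) (b t₀))).mono
      fun t ht => (inChart_mfderiv θ ht (V t)).symm)
    (inChart_mfderiv θ (mem_extChartAt_source (b t₀)) (V t₀)).symm

theorem mfderivWithin_prod_univ_apply {𝕜 E H N E' H' P E'' H'' Q : Type*}
    [NontriviallyNormedField 𝕜]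
    [NormedAddCommGroup E] [NormedSpace 𝕜 E] [TopologicalSpace H] {I : ModelWithCorners 𝕜 E H}
    [TopologicalSpace N] [ChartedSpace H N]
    [NormedAddCommGroup E'] [NormedSpace 𝕜 E'] [TopologicalSpace H']
    {I' : ModelWithCorners 𝕜 E' H'} [TopologicalSpace P] [ChartedSpace H' P]
    [NormedAddCommGroup E''] [NormedSpace 𝕜 E''] [TopologicalSpace H'']
    {I'' : ModelWithCorners 𝕜 E'' H''} [TopologicalSpace Q] [ChartedSpace H'' Q]
    {f : N × P → Q} {s : Set N} {t : N} {x : P} (ht : t ∈ s)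
    (hf : MDifferentiableWithinAt (I.prod I') I'' f (s ×ˢ univ) (t, x)) (u : TangentSpace I' x) :
    mfderivWithin (I.prod I') I'' f (s ×ˢ univ) (t, x) ((0, u) : E × E') =
      mfderiv I' I'' (fun y => f (t, y)) x u := by
  have hslice : MDifferentiableAt I' (I.prod I') (fun y : P => (t, y)) x :=
    mdifferentiableAt_const.prodMk mdifferentiableAt_id
  have hcomp := mfderivWithin_comp (I := I') x (f := fun y : P => (t, y)) (s := univ) hf
    hslice.mdifferentiableWithinAt (fun y _ => ⟨ht, mem_univ _⟩) (uniqueMDiffWithinAt_univ _)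
  rw [mfderivWithin_univ, mfderivWithin_univ, mfderiv_prod_right] at hcomp
  exact (DFunLike.congr_fun hcomp u).symm

theorem continuousOn_mfderiv_of_isSmoothIsotopy {F : ℝ → Diffeo d M} (hF : IsSmoothIsotopy F)
    (x : M) (u : TangentSpace (𝓡 d) x) :
    ContinuousOn (fun t => (⟨F t x, mfderiv (𝓡 d) (𝓡 d) (F t) x u⟩ : TangentBundle (𝓡 d) M))
      (Icc 0 1) := by
  have hunique : UniqueMDiffOn (𝓘(ℝ, ℝ).prod (𝓡 d)) (Icc (0 : ℝ) 1 ×ˢ (univ : Set M)) :=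
    (uniqueDiffOn_Icc zero_lt_one).uniqueMDiffOn.prod uniqueMDiffOn_univ
  have hzero : Continuous fun t : ℝ => (⟨t, 0⟩ : TangentBundle 𝓘(ℝ, ℝ) ℝ) :=
    (Bundle.contMDiff_zeroSection (n := 0) (IB := 𝓘(ℝ, ℝ)) ℝ
      (TangentSpace 𝓘(ℝ, ℝ) (M := ℝ))).continuous
  have hlift : Continuous fun t : ℝ =>
      (equivTangentBundleProd 𝓘(ℝ, ℝ) ℝ (𝓡 d) M).symm (⟨t, 0⟩, ⟨x, u⟩) :=
    (contMDiff_equivTangentBundleProd_symm (n := 0)).continuous.comp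
      (hzero.prodMk continuous_const)
  refine ((hF.continuousOn_tangentMapWithin (by simp) hunique).comp hlift.continuousOn
    fun t ht => ⟨ht, mem_univ _⟩).congr fun t ht => ?_
  exact congrArg (Bundle.TotalSpace.mk (F t x)) (mfderivWithin_prod_univ_apply ht
    ((hF (t, x) ⟨ht, mem_univ _⟩).mdifferentiableWithinAt (by simp)) u).symm

theorem continuousOn_pullback_apply {θ : ∀ x : M, TangentSpace (𝓡 d) x [⋀^Fin p]→L[ℝ] ℝ}
    (hθ : ∀ x₀, ContinuousOn (inChart θ x₀) (extChartAt (𝓡 d) x₀).target)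
    {F : ℝ → Diffeo d M} (hF : IsSmoothIsotopy F) (x : M) (v : Fin p → TangentSpace (𝓡 d) x) :
    ContinuousOn (fun t => pullback (F t) (fun y => (θ y).toAlternatingMap) x v) (Icc 0 1) :=
  fun t₀ ht₀ => continuousWithinAt_form_apply (hθ _)
    (hF.continuousOn.comp (continuousOn_id.prodMk continuousOn_const)
      (fun _ ht => ⟨ht, mem_univ _⟩) t₀ ht₀)
    fun i => continuousOn_mfderiv_of_isSmoothIsotopy hF x (v i) t₀ ht₀

end Continuity

theorem eq_of_continuousOn_of_eq_or_eq_neg {V T : Type*} [AddCommGroup V] [Module ℝ V]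
    [TopologicalSpace T] {s : Set T} (hs : IsPreconnected s) {β : T → V [⋀^Fin p]→ₗ[ℝ] ℝ}
    {α : V [⋀^Fin p]→ₗ[ℝ] ℝ} (hβ : ∀ v, ContinuousOn (fun t => β t v) s)
    (hsign : ∀ t ∈ s, β t = α ∨ β t = -α) {t₀ t : T} (ht₀ : t₀ ∈ s) (hα : β t₀ = α)
    (ht : t ∈ s) : β t = α := by
  ext v
  by_cases hv : α v = 0
  · rcases hsign t ht with h | h <;> simp [h, hv]
  · refine hs.eq_of_sq_eq (hβ v) continuousOn_const (fun r hr => ?_) (fun _ => hv) ht₀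
      (by simp [hα]) ht
    rcases hsign r hr with h | h <;> simp [h]

theorem identityComponent_mono_of_isotopy {H H' : Subgroup (Diffeo d M)}
    (h : ∀ F : ℝ → Diffeo d M, IsSmoothIsotopy F → F 0 = 1 → (∀ t ∈ Icc (0 : ℝ) 1, F t ∈ H) →
      ∀ t ∈ Icc (0 : ℝ) 1, F t ∈ H') : identityComponent H ≤ identityComponent H' := by
  rintro f ⟨F, hF, hFH, hF0, hF1⟩
  exact ⟨F, hF, h F hF hF0 hFH, hF0, hF1⟩

theorem pullback_wedgePow (f : Diffeo d M)
    (θ : ∀ x : M, TangentSpace (𝓡 d) x [⋀^Fin p]→ₗ[ℝ] ℝ) (k : ℕ) (x : M) :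
    pullback f (fun y => wedgePow (θ y) k) x = wedgePow (pullback f θ x) k :=
  (wedgePow_compLinearMap _ _ _).symm

theorem diffPreserving_le_diffPreserving_wedgePow
    (θ : ∀ x : M, TangentSpace (𝓡 d) x [⋀^Fin p]→ₗ[ℝ] ℝ) (k : ℕ) :
    diffPreserving θ ≤ diffPreserving fun x => wedgePow (θ x) k := fun f hf =>
  funext fun x => (pullback_wedgePow f θ k x).trans (congrArg (wedgePow · k) (congrFun hf x))

theorem pullback_eq_of_wedgePow_eq [IsManifold (𝓡 d) 1 M]
    {θ : ∀ x : M, TangentSpace (𝓡 d) x [⋀^Fin 2]→L[ℝ] ℝ}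
    (hθ : ∀ x₀, ContinuousOn (inChart θ x₀) (extChartAt (𝓡 d) x₀).target)
    {k : ℕ} (hk : k ≠ 0) {x : M}
    (hrank : 2 * k < Module.finrank ℝ (LinearMap.range (toBilin (θ x).toAlternatingMap)))
    {F : ℝ → Diffeo d M} (hF : IsSmoothIsotopy F) (hF₀ : F 0 = 1)
    (hFk : ∀ t ∈ Icc (0 : ℝ) 1,
      pullback (F t) (fun y => wedgePow (θ y).toAlternatingMap k) x =
        wedgePow (θ x).toAlternatingMap k) {t : ℝ} (ht : t ∈ Icc (0 : ℝ) 1) :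
    pullback (F t) (fun y => (θ y).toAlternatingMap) x = (θ x).toAlternatingMap := by
  have : FiniteDimensional ℝ (TangentSpace (𝓡 d) x) :=
    inferInstanceAs (FiniteDimensional ℝ (EuclideanSpace ℝ (Fin d)))
  refine eq_of_continuousOn_of_eq_or_eq_neg isPreconnected_Icc
    (continuousOn_pullback_apply hθ hF x) (fun r hr => ?_) (left_mem_Icc.mpr zero_le_one) ?_ ht
  · refine eq_or_eq_neg_of_wedgePow_eq hk hrank ?_
    rw [← pullback_wedgePow, hFk r hr]
  · rw [hF₀, pullback_one]

theorem SymplecticForm.finrank_range_toBilin (Ω : SymplecticForm d M) (x : M) :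
    Module.finrank ℝ (LinearMap.range (toBilin (Ω.form x).toAlternatingMap)) = d := by
  have hinj : Function.Injective (toBilin (Ω.form x).toAlternatingMap) :=
    (injective_iff_map_eq_zero _).mpr fun v hv =>
      Ω.nondegenerate x v fun w => LinearMap.congr_fun hv w
  exact (LinearMap.finrank_range_of_inj hinj).trans finrank_euclideanSpace_fin

end Manifold

end SymplecticPower

open SymplecticPower in
theorem mainTheorem3_general {d k : ℕ} (hk : 0 < k) {M : Type*} [TopologicalSpace M]
    [ChartedSpace (EuclideanSpace ℝ (Fin d)) M] [IsManifold (𝓡 d) ∞ M]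
    (θ : ∀ x : M, TangentSpace (𝓡 d) x [⋀^Fin 2]→L[ℝ] ℝ)
    (hθ : ∀ x₀, ContinuousOn (inChart θ x₀) (extChartAt (𝓡 d) x₀).target)
    (hrank : ∀ x,
      2 * k < Module.finrank ℝ (LinearMap.range (toBilin (θ x).toAlternatingMap))) :
    identityComponent (diffPreserving fun x => wedgePow (θ x).toAlternatingMap k) =
      identityComponent (diffPreserving fun x => (θ x).toAlternatingMap) := by
  have : IsManifold (𝓡 d) 1 M := IsManifold.of_le (n := ∞) (by simp)
  apply le_antisymm
  · exact identityComponent_mono_of_isotopy fun F hF hF₀ hFk t ht => funext fun x =>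
      pullback_eq_of_wedgePow_eq hθ hk.ne' (hrank x) hF hF₀ (fun r hr => congrFun (hFk r hr) x) ht
  · exact identityComponent_mono_of_isotopy fun F _ _ hFθ t ht =>
      diffPreserving_le_diffPreserving_wedgePow _ k (hFθ t ht)

theorem mainTheorem3 {n k : ℕ} (hn : 3 ≤ n) (hk : 0 < k) (hkn : k < n)
    {M : Type*} [TopologicalSpace M] [T2Space M] [CompactSpace M] [ConnectedSpace M]
    [ChartedSpace (EuclideanSpace ℝ (Fin (2 * n))) M] [IsManifold (𝓡 (2 * n)) ∞ M]
    (Ω : SymplecticPower.SymplecticForm (2 * n) M) :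
    SymplecticPower.diff₀ Ω k = SymplecticPower.symp₀ Ω :=
  mainTheorem3_general hk Ω.form (fun x₀ => (Ω.smooth x₀).continuousOn) fun x => by
    rw [Ω.finrank_range_toBilin]
    omega
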